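/- All systems are finite-dimensional, of dimension at least one. A system is trivial ($\mathsf I$) if it has dimension one, classical ($\mathsf C$) if its operators are restricted to the diagonal ones, and quantum ($\mathsf Q$) if all operators are allowed. A bipartite resource of type $\mathsf{T}_X\mathsf{T}_Y\to\mathsf{T}_A\mathsf{T}_B$ is a completely positive trace-preserving map from Alice's and Bob's inputs $X,Y$ (of kinds $\mathsf T_X,\mathsf T_Y$) to their outputs $A,B$ (of kinds $\mathsf T_A,\mathsf T_B$) that is nonsignaling in both directions. It is LOSE-free if it has the form $(\Lambda_A\otimes\Lambda_B)(\,\cdot\,\otimes\rho)$ with $\rho$ a shared (possibly entangled) finite-dimensional quantum state and $\Lambda_A,\Lambda_B$ local channels; a type is LOSE-trivial if every resource of that type is LOSE-free. A LOSE transformation $\tau$ of resources consists of a local quantum comb for each party, both acting on a shared quantum state. A game $G$ for given input and output systems is a real-valued linear map on the resources with these systems; the optimal performance of a resource $R$ of arbitrary type is $\omega_G(R)=\max_\tau G(\tau\circ R)$ over the LOSE transformations $\tau$ from $R$ to the systems of the game. A GPT is a causal theory of processes (a symmetric monoidal category whose unit is terminal) containing finite-dimensional quantum theory; a channel is realized by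 a common cause in the GPT if it is obtained from a bipartite state of the GPT by local processes of the GPT. **Corollary.** The type $\mathsf{CI}\to\mathsf{CQ}$ (steering assemblages) and the type $\mathsf{QI}\to\mathsf{CQ}$ (teleportages) are LOSE-trivial. Moreover, for systems $X,Y,A,B$ of either of these two types: 1. every channel with these systems that is realized by a common cause in some GPT is LOSE-free; 2. for every game $G$ with these systems (every steering game, respectively teleportation game), the maximum $\omega$ of $G(\mathcal E)$ over all LOSE-free channels $\mathcal E$ exists; every channel $\mathcal E$ that is realized by a common cause in some GPT satisfies $G(\mathcal E)\le\omega$; and every nonsignaling resource $R$, of arbitrary type, satisfies $\omega_G(R)=\omega$, the maximum being attained. That is, no GPT can outperform quantum theory at any steering game or teleportation game. -/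

import Mathlib

/-! Finite-dimensional quantum theory as a symmetric monoidal category of channels, bipartite
nonsignaling resources, local operations and shared entanglement (LOSE), distributed games, and
generalized probabilistic theories (GPTs). -/

universe u v

noncomputable section

namespace LOSE

open CategoryTheory MonoidalCategory
open scoped ComplexOrder

/-! ### Systems and channels -/

/-- A finite-dimensional quantum system, with Hilbert space `ℂ ^ carrier` of dimension at least
one. -/
structure QSys where
  carrier : Type
  [fintype : Fintype carrier]
  [decEq : DecidableEq carrier]
  [nonempty : Nonempty carrier]

attribute [instance] QSys.fintype QSys.decEq QSys.nonempty

/-- The operators on the Hilbert space of a system. -/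
abbrev QSys.Op (X : QSys) : Type := Matrix X.carrier X.carrier ℂ

/-- The composite of two systems. -/
abbrev QSys.tensor (X Y : QSys) : QSys := ⟨X.carrier × Y.carrier⟩

/-- The one-dimensional system. -/
abbrev QSys.unit : QSys := ⟨PUnit.{1}⟩

/-- The map `f ⊗ id` on operators on `ℂ ^ X ⊗ ℂ ^ κ`, acting blockwise. -/
def ampliation {X Y : QSys} (f : X.Op →ₗ[ℂ] Y.Op) {κ : Type}
    (M : Matrix (X.carrier × κ) (X.carrier × κ) ℂ) :
    Matrix (Y.carrier × κ) (Y.carrier × κ) ℂ :=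
  Matrix.of fun p q => f (Matrix.of fun x z => M (x, p.2) (z, q.2)) p.1 q.1

/-- Complete positivity: `f ⊗ id` preserves positive semidefiniteness, for every
finite-dimensional ancilla. -/
def IsCompletelyPositive {X Y : QSys} (f : X.Op →ₗ[ℂ] Y.Op) : Prop :=
  ∀ (κ : Type) [Fintype κ] (M : Matrix (X.carrier × κ) (X.carrier × κ) ℂ),
    M.PosSemidef → (ampliation f M).PosSemidef

/-- Quantum channels: completely positive trace-preserving maps. -/
@[ext]
structure Channel (X Y : QSys) where
  map : X.Op →ₗ[ℂ] Y.Op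
  cp : IsCompletelyPositive map
  tp : ∀ M, (map M).trace = M.trace

/-- The tensor product of two linear maps on operators; on product operators it is
`M ⊗ N ↦ f M ⊗ g N`, see `tensorMap_kronecker`. -/
def tensorMap {X Y A B : QSys} (f : X.Op →ₗ[ℂ] A.Op) (g : Y.Op →ₗ[ℂ] B.Op) :
    (X.tensor Y).Op →ₗ[ℂ] (A.tensor B).Op where
  toFun M := Matrix.of fun p q =>
    f (Matrix.of fun x x' => g (Matrix.of fun y y' => M (x, y) (x', y')) p.2 q.2) p.1 q.1
  map_add' M N := by
    ext p q
    have h : (Matrix.of fun x x' => g (Matrix.of fun y y' => (M + N) (x, y) (x', y')) p.2 q.2 :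
        X.Op) = (Matrix.of fun x x' => g (Matrix.of fun y y' => M (x, y) (x', y')) p.2 q.2) +
          Matrix.of fun x x' => g (Matrix.of fun y y' => N (x, y) (x', y')) p.2 q.2 := by
      ext x x'
      exact congrFun (congrFun (map_add g (Matrix.of fun y y' => M (x, y) (x', y'))
        (Matrix.of fun y y' => N (x, y) (x', y'))) p.2) q.2
    exact (congrArg (fun T => f T p.1 q.1) h).trans (congrFun (congrFun (map_add f _ _) p.1) q.1)
  map_smul' c M := by
    ext p q
    have h : (Matrix.of fun x x' => g (Matrix.of fun y y' => (c • M) (x, y) (x', y')) p.2 q.2 :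
        X.Op) =
        c • (Matrix.of fun x x' => g (Matrix.of fun y y' => M (x, y) (x', y')) p.2 q.2) := by
      ext x x'
      exact congrFun (congrFun (map_smul g c (Matrix.of fun y y' => M (x, y) (x', y'))) p.2) q.2
    exact (congrArg (fun T => f T p.1 q.1) h).trans (congrFun (congrFun (map_smul f c _) p.1) q.1)

open scoped Kronecker in
theorem tensorMap_kronecker {X Y A B : QSys} (f : X.Op →ₗ[ℂ] A.Op) (g : Y.Op →ₗ[ℂ] B.Op)
    (M : X.Op) (N : Y.Op) : tensorMap f g (M ⊗ₖ N) = f M ⊗ₖ g N := by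
  ext p q
  have h : (Matrix.of fun x x' => g (Matrix.of fun y y' => (M ⊗ₖ N) (x, y) (x', y')) p.2 q.2 :
      X.Op) = g N p.2 q.2 • M := by
    ext x x'
    refine (congrFun (congrFun (map_smul g (M x x') N) p.2) q.2).trans ?_
    simp [mul_comm]
  refine (congrArg (fun T => f T p.1 q.1) h).trans ?_
  simp [mul_comm]

open scoped Kronecker in
theorem ext_kronecker {X Y A : QSys} {f g : (X.tensor Y).Op →ₗ[ℂ] A.Op}
    (h : ∀ (M : X.Op) (N : Y.Op), f (M ⊗ₖ N) = g (M ⊗ₖ N)) : f = g := by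
  apply Matrix.ext_linearMap
  rintro ⟨x, y⟩ ⟨x', y'⟩
  apply LinearMap.ext_ring
  have := h (Matrix.single x x' 1) (Matrix.single y y' 1)
  simpa [Matrix.single_kronecker_single] using this

theorem tensorMap_cp {X Y A B : QSys} {f : X.Op →ₗ[ℂ] A.Op} {g : Y.Op →ₗ[ℂ] B.Op}
    (hf : IsCompletelyPositive f) (hg : IsCompletelyPositive g) :
    IsCompletelyPositive (tensorMap f g) := by
  intro κ _ M hM
  have h1 := hg (X.carrier × κ) _ (hM.submatrix (fun p : Y.carrier × X.carrier × κ =>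
    ((p.2.1, p.1), p.2.2)))
  have h2 := hf (B.carrier × κ) _ (h1.submatrix (fun p : X.carrier × B.carrier × κ =>
    (p.2.1, p.1, p.2.2)))
  exact h2.submatrix (fun p : (A.carrier × B.carrier) × κ => (p.1.1, p.1.2, p.2))

theorem tensorMap_tp {X Y A B : QSys} {f : X.Op →ₗ[ℂ] A.Op} {g : Y.Op →ₗ[ℂ] B.Op}
    (hf : ∀ M, (f M).trace = M.trace) (hg : ∀ M, (g M).trace = M.trace) (M : (X.tensor Y).Op) :
    (tensorMap f g M).trace = M.trace := by
  have h : (Matrix.traceLinearMap _ ℂ ℂ).comp (tensorMap f g) = Matrix.traceLinearMap _ ℂ ℂ := by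
    apply Matrix.ext_linearMap
    rintro ⟨x, y⟩ ⟨x', y'⟩
    apply LinearMap.ext_ring
    have := tensorMap_kronecker f g (Matrix.single x x' 1) (Matrix.single y y' 1)
    rw [Matrix.single_kronecker_single, mul_one] at this
    simp only [LinearMap.comp_apply, Matrix.singleLinearMap_apply, this,
      Matrix.traceLinearMap_apply, Matrix.trace_kronecker, hf, hg]
    rw [← Matrix.trace_kronecker, Matrix.single_kronecker_single, mul_one]
  exact LinearMap.congr_fun h M

theorem tensorMap_comp {X Y A B A' B' : QSys} (f : X.Op →ₗ[ℂ] A.Op) (g : Y.Op →ₗ[ℂ] B.Op)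
    (f' : A.Op →ₗ[ℂ] A'.Op) (g' : B.Op →ₗ[ℂ] B'.Op) :
    (tensorMap f' g').comp (tensorMap f g) = tensorMap (f'.comp f) (g'.comp g) :=
  ext_kronecker fun M N => by simp [tensorMap_kronecker]

namespace Channel

/-- The tensor product of channels. -/
def tensor {X Y A B : QSys} (f : Channel X A) (g : Channel Y B) :
    Channel (X.tensor Y) (A.tensor B) where
  map := tensorMap f.map g.map
  cp := tensorMap_cp f.cp g.cp
  tp := tensorMap_tp f.tp g.tp

/-- The relabelling of basis vectors along a bijection. -/
def relabel {X Y : QSys} (e : Y.carrier ≃ X.carrier) : Channel X Y where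
  map :=
    { toFun := fun M => M.submatrix e e
      map_add' := fun _ _ => rfl
      map_smul' := fun _ _ => rfl }
  cp := fun κ _ _ hM => hM.submatrix (fun p : Y.carrier × κ => (e p.1, p.2))
  tp := fun M => e.sum_comp (fun x => M x x)

end Channel

instance : Category QSys where
  Hom := Channel
  id X := ⟨LinearMap.id, fun _ _ _ hM => hM, fun _ => rfl⟩
  comp f g := ⟨g.map.comp f.map, fun κ _ _ hM => g.cp κ _ (f.cp κ _ hM),
    fun M => (g.tp _).trans (f.tp M)⟩

/-- Relabelling along a bijection is invertible. -/
def relabelIso {X Y : QSys} (e : Y.carrier ≃ X.carrier) : X ≅ Y where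
  hom := Channel.relabel e
  inv := Channel.relabel e.symm
  hom_inv_id := Channel.ext (LinearMap.ext fun M => by
    change (M.submatrix e e).submatrix e.symm e.symm = M
    simp)
  inv_hom_id := Channel.ext (LinearMap.ext fun M => by
    change (M.submatrix e.symm e.symm).submatrix e e = M
    simp)

instance : MonoidalCategoryStruct QSys where
  tensorObj := QSys.tensor
  whiskerLeft X _ _ f := Channel.tensor (𝟙 X) f
  whiskerRight f Y := Channel.tensor f (𝟙 Y)
  tensorHom f g := Channel.tensor f g
  tensorUnit := QSys.unit
  associator X Y Z := relabelIso (Equiv.prodAssoc X.carrier Y.carrier Z.carrier).symm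
  leftUnitor X := relabelIso (Equiv.punitProd X.carrier).symm
  rightUnitor X := relabelIso (Equiv.prodPUnit X.carrier).symm

instance : MonoidalCategory QSys :=
  MonoidalCategory.ofTensorHom
    (id_tensorHom_id := fun _ _ => rfl)
    (id_tensorHom := fun _ _ _ _ => rfl)
    (tensorHom_id := fun _ _ => rfl)
    (tensorHom_comp_tensorHom := fun f₁ f₂ g₁ g₂ =>
      Channel.ext (tensorMap_comp f₁.map f₂.map g₁.map g₂.map))
    (associator_naturality := fun _ _ _ => rfl)
    (leftUnitor_naturality := fun _ => rfl)
    (rightUnitor_naturality := fun _ => rfl)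
    (pentagon := fun _ _ _ _ => rfl)
    (triangle := fun _ _ => rfl)

open scoped Kronecker in
theorem tensor_swap {X Y A B : QSys} (f : Channel X A) (g : Channel Y B) :
    (Channel.tensor f g ≫ (relabelIso (Equiv.prodComm B.carrier A.carrier)).hom :
      X.tensor Y ⟶ B.tensor A) =
    (relabelIso (Equiv.prodComm Y.carrier X.carrier)).hom ≫ Channel.tensor g f := by
  apply Channel.ext
  apply ext_kronecker
  intro M N
  have hs : ∀ {U V : QSys} (P : U.Op) (Q : V.Op),
      (P ⊗ₖ Q).submatrix (Equiv.prodComm V.carrier U.carrier) (Equiv.prodComm _ _) = Q ⊗ₖ P := by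
    intro U V P Q
    ext p q
    simp [mul_comm]
  change (tensorMap f.map g.map (M ⊗ₖ N)).submatrix _ _ =
    tensorMap g.map f.map ((M ⊗ₖ N).submatrix _ _)
  rw [hs, tensorMap_kronecker, tensorMap_kronecker, hs]

instance : SymmetricCategory QSys where
  braiding X Y := relabelIso (Equiv.prodComm Y.carrier X.carrier)
  braiding_naturality_right X _ _ f := tensor_swap (𝟙 X) f
  braiding_naturality_left f Z := tensor_swap f (𝟙 Z)
  hexagon_forward _ _ _ := rfl
  hexagon_reverse _ _ _ := rfl
  symmetry _ _ := rfl

/-- The trace, as a map to the operators of the one-dimensional system. -/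
def traceMap (X : QSys) : X.Op →ₗ[ℂ] QSys.unit.Op where
  toFun M := Matrix.of fun _ _ => M.trace
  map_add' M N := by ext; simp [Matrix.trace_add]
  map_smul' c M := by ext; simp [Matrix.trace_smul]

/-- Discarding a system: the trace. -/
def discard (X : QSys) : X ⟶ 𝟙_ QSys where
  map := traceMap X
  cp := by
    intro κ _ M hM
    have h : ampliation (traceMap X) M =
        ∑ x : X.carrier, M.submatrix (fun p : PUnit × κ => (x, p.2)) fun p => (x, p.2) := by
      ext p q
      simp [ampliation, traceMap, Matrix.trace, Matrix.sum_apply]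
    exact h ▸ Matrix.posSemidef_sum _ fun x _ => hM.submatrix _
  tp := fun M => Fintype.sum_unique (ι := PUnit) _

/-- Replacing the off-diagonal entries by zero. -/
def diagonalMap (X : QSys) : X.Op →ₗ[ℂ] X.Op where
  toFun M := Matrix.diagonal M.diag
  map_add' M N := by ext i j; by_cases h : i = j <;> simp [h]
  map_smul' c M := by ext i j; by_cases h : i = j <;> simp [h]

/-- Complete dephasing in the standard basis. -/
def dephase (X : QSys) : X ⟶ X where
  map := diagonalMap X
  cp := by
    classical
    intro κ _ M hM
    have h : ampliation (diagonalMap X) M =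
        ∑ x : X.carrier,
          (Matrix.diagonal fun p : X.carrier × κ => if p.1 = x then (1 : ℂ) else 0).conjTranspose *
            M * Matrix.diagonal fun p : X.carrier × κ => if p.1 = x then (1 : ℂ) else 0 := by
      ext ⟨a, i⟩ ⟨b, j⟩
      rw [Matrix.sum_apply]
      simp only [ampliation, diagonalMap, Matrix.diagonal_conjTranspose,
        Matrix.mul_diagonal, Matrix.diagonal_mul, Matrix.of_apply, LinearMap.coe_mk,
        AddHom.coe_mk, Matrix.diagonal_apply, Matrix.diag_apply, Pi.star_apply, apply_ite star,
        star_one, star_zero]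
      by_cases hab : a = b
      · subst hab; simp
      · simp [hab]
    exact h ▸ Matrix.posSemidef_sum _ fun x _ => hM.conjTranspose_mul_mul_same _
  tp := fun M => by simp [diagonalMap, Matrix.trace]

/-! ### Common-cause processes -/

/-- The common-cause diagram in a symmetric monoidal category: the bipartite state `s` is
distributed to the two parties, who apply `f` and `g` to their input and their share. -/
def commonCause {C : Type u} [Category.{v} C] [MonoidalCategory C] [SymmetricCategory C]
    {X Y A B S S' : C} (s : 𝟙_ C ⟶ S ⊗ S') (f : X ⊗ S ⟶ A) (g : Y ⊗ S' ⟶ B) :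
    X ⊗ Y ⟶ A ⊗ B :=
  (ρ_ (X ⊗ Y)).inv ≫ ((X ⊗ Y) ◁ s) ≫ tensorμ X Y S S' ≫ (f ⊗ₘ g)

/-! ### Types and resources -/

/-- Trivial, classical and quantum systems. -/
inductive Kind
  | I
  | C
  | Q

/-- A system together with its kind; a trivial system has dimension one. -/
structure System where
  sys : QSys
  kind : Kind
  card_of_trivial : kind = Kind.I → Fintype.card sys.carrier = 1

/-- The projection onto the operators of the system: on a classical system these are the diagonal
operators, otherwise all operators. -/
def System.proj (X : System) : X.sys ⟶ X.sys :=
  match X.kind with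
  | Kind.I => 𝟙 _
  | Kind.C => dephase _
  | Kind.Q => 𝟙 _

/-- A global type `XY → AB`. -/
structure GlobalType where
  X : Kind
  Y : Kind
  A : Kind
  B : Kind

/-- Steering assemblages: `CI → CQ`. -/
def GlobalType.steering : GlobalType := ⟨Kind.C, Kind.I, Kind.C, Kind.Q⟩

/-- Teleportages: `QI → CQ`. -/
def GlobalType.teleportage : GlobalType := ⟨Kind.Q, Kind.I, Kind.C, Kind.Q⟩

/-- The input systems `X`, `Y` and the output systems `A`, `B` of the two parties. -/
structure Scenario where
  X : System
  Y : System
  A : System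
  B : System

/-- The global type of a scenario. -/
def Scenario.type (P : Scenario) : GlobalType := ⟨P.X.kind, P.Y.kind, P.A.kind, P.B.kind⟩

/-- Bipartite channels between the systems of a scenario. -/
abbrev Scenario.Chan (P : Scenario) : Type := P.X.sys ⊗ P.Y.sys ⟶ P.A.sys ⊗ P.B.sys

/-- The channel is a map from the operators of its input systems to the operators of its output
systems: classical inputs and outputs are dephased. -/
def Scenario.Typed (P : Scenario) (E : P.Chan) : Prop :=
  (P.X.proj ⊗ₘ P.Y.proj) ≫ E ≫ (P.A.proj ⊗ₘ P.B.proj) = E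

/-- The marginal output of Bob does not depend on the input of Alice. -/
def Scenario.NonsignalingAliceToBob (P : Scenario) (E : P.Chan) : Prop :=
  ∃ F : P.Y.sys ⟶ P.B.sys,
    E ≫ (discard P.A.sys ▷ P.B.sys) = (discard P.X.sys ▷ P.Y.sys) ≫ (𝟙_ QSys ◁ F)

/-- The marginal output of Alice does not depend on the input of Bob. -/
def Scenario.NonsignalingBobToAlice (P : Scenario) (E : P.Chan) : Prop :=
  ∃ F : P.X.sys ⟶ P.A.sys,
    E ≫ (P.A.sys ◁ discard P.B.sys) = (P.X.sys ◁ discard P.Y.sys) ≫ (F ▷ 𝟙_ QSys)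

/-- Resources: nonsignaling bipartite channels of the given type. -/
structure Scenario.IsResource (P : Scenario) (E : P.Chan) : Prop where
  typed : P.Typed E
  nonsignaling_left : P.NonsignalingAliceToBob E
  nonsignaling_right : P.NonsignalingBobToAlice E

/-- A local channel with input `X` and a quantum ancilla `S`, and output `A` and a quantum
ancilla `M`, that respects the kinds of `X` and `A`. -/
def TypedLocal (X A : System) {S M : QSys} (f : X.sys ⊗ S ⟶ A.sys ⊗ M) : Prop :=
  (X.proj ▷ S) ≫ f ≫ (A.proj ▷ M) = f

/-- LOSE-free channels: those obtained from a shared (entangled) quantum state by local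
channels. -/
def Scenario.IsFree (P : Scenario) (E : P.Chan) : Prop :=
  ∃ (S S' : QSys) (s : 𝟙_ QSys ⟶ S ⊗ S') (f : P.X.sys ⊗ S ⟶ P.A.sys)
    (g : P.Y.sys ⊗ S' ⟶ P.B.sys),
    (P.X.proj ▷ S) ≫ f ≫ P.A.proj = f ∧ (P.Y.proj ▷ S') ≫ g ≫ P.B.proj = g ∧
      commonCause s f g = E

/-- A type is LOSE-trivial if every resource of that type is LOSE-free. -/
def LOSETrivial (T : GlobalType) : Prop :=
  ∀ P : Scenario, P.type = T → ∀ E : P.Chan, P.IsResource E → P.IsFree E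

/-! ### LOSE transformations -/

/-- A LOSE transformation of channels of scenario `P` to channels of scenario `R`: each party
applies a local comb (a preprocessing and a postprocessing, connected by a quantum memory), and
the combs act on a shared (entangled) quantum state. -/
structure LOSETransformation (P R : Scenario) where
  SA : QSys
  SB : QSys
  MA : QSys
  MB : QSys
  state : 𝟙_ QSys ⟶ SA ⊗ SB
  preA : R.X.sys ⊗ SA ⟶ P.X.sys ⊗ MA
  preB : R.Y.sys ⊗ SB ⟶ P.Y.sys ⊗ MB
  postA : P.A.sys ⊗ MA ⟶ R.A.sys
  postB : P.B.sys ⊗ MB ⟶ R.B.sys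
  preA_typed : TypedLocal R.X P.X preA
  preB_typed : TypedLocal R.Y P.Y preB
  postA_typed : (P.A.proj ▷ MA) ≫ postA ≫ R.A.proj = postA
  postB_typed : (P.B.proj ▷ MB) ≫ postB ≫ R.B.proj = postB

/-- The action of a LOSE transformation on a channel. -/
def LOSETransformation.apply {P R : Scenario} (τ : LOSETransformation P R) (E : P.Chan) :
    R.Chan :=
  commonCause τ.state τ.preA τ.preB ≫ tensorμ P.X.sys τ.MA P.Y.sys τ.MB ≫
    (E ▷ (τ.MA ⊗ τ.MB)) ≫ tensorμ P.A.sys P.B.sys τ.MA τ.MB ≫ (τ.postA ⊗ₘ τ.postB)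

/-! ### Games -/

/-- Distributed games of a given type: real-valued linear maps on the channels of that type. -/
abbrev Scenario.Game (P : Scenario) : Type :=
  ((P.X.sys ⊗ P.Y.sys).Op →ₗ[ℂ] (P.A.sys ⊗ P.B.sys).Op) →ₗ[ℝ] ℝ

/-- The score of a strategy. -/
def Scenario.Game.score {P : Scenario} (G : P.Game) (E : P.Chan) : ℝ := G (Channel.map E)

/-- `ω` is the optimal performance of the shared resource `E` at the game `G`: the maximum of the
scores of the strategies that LOSE transformations can generate from `E`. -/
def IsOptimalPerformance {P R : Scenario} (G : R.Game) (E : P.Chan) (ω : ℝ) : Prop :=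
  IsGreatest (Set.range fun τ : LOSETransformation P R => G.score (τ.apply E)) ω

/-- `ω` is the optimal quantum score at the game `G`: the maximum of the scores of the strategies
that can be generated by local operations and shared entanglement. -/
def IsOptimalQuantumScore {R : Scenario} (G : R.Game) (ω : ℝ) : Prop :=
  IsGreatest (G.score '' {E | R.IsFree E}) ω

/-! ### Generalized probabilistic theories -/

/-- A GPT, as a theory of (deterministic) processes that contains quantum theory: a symmetric
monoidal category of systems and processes which is causal (each system has a unique discarding
process, that is, the monoidal unit is terminal), together with a faithful embedding of
finite-dimensional quantum theory that preserves sequential and parallel composition. Nothing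
further, such as convexity, tomographic locality or fullness of the embedding, is demanded. -/
structure GPT where
  Sys : Type u
  [category : Category.{v} Sys]
  [monoidal : MonoidalCategory Sys]
  [symmetric : SymmetricCategory Sys]
  causal : Limits.IsTerminal (𝟙_ Sys)
  quantum : QSys ⥤ Sys
  [braided : quantum.Braided]
  [faithful : quantum.Faithful]

attribute [instance] GPT.category GPT.monoidal GPT.symmetric GPT.braided GPT.faithful

/-- The channel `E` between the systems of `P` can be realized by a common cause in the GPT `𝒢`:
it arises from a bipartite state of `𝒢` by local processes of `𝒢`. -/
def GPT.Realizes (𝒢 : GPT.{u, v}) {P : Scenario} (E : P.Chan) : Prop :=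
  ∃ (S S' : 𝒢.Sys) (s : 𝟙_ 𝒢.Sys ⟶ S ⊗ S')
    (f : 𝒢.quantum.obj P.X.sys ⊗ S ⟶ 𝒢.quantum.obj P.A.sys)
    (g : 𝒢.quantum.obj P.Y.sys ⊗ S' ⟶ 𝒢.quantum.obj P.B.sys),
    Functor.LaxMonoidal.μ 𝒢.quantum P.X.sys P.Y.sys ≫ 𝒢.quantum.map E =
      commonCause s f g ≫ Functor.LaxMonoidal.μ 𝒢.quantum P.A.sys P.B.sys

end LOSE

end

/-!
In the types `CI → CQ` and `QI → CQ` Bob has no input, and everything follows from one fact: if Bob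
has no input, then the LOSE-free channels are exactly the typed channels that are nonsignaling from
Alice to Bob (`Scenario.isFree_of_nonsignalingAliceToBob`).

This is a form of the Hughston–Jozsa–Wootters theorem. Write such a channel as its Choi matrix
`J` on `X ⊗ A ⊗ B`; nonsignaling says that its marginal on `X ⊗ B` is `1 ⊗ σ`, where `σ` is
Bob's output state. Let `T` be a square root of `σ` with pseudoinverse `R`. Then
`(1 ⊗ R) J (1 ⊗ R)ᴴ`, completed on the kernel of `R T`, is the Choi matrix of a channel from
Alice's input and one half of the purification `∑ |s⟩ ⊗ T|s⟩` of `σ` to Alice's output. Applied to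
the purification it returns `(1 ⊗ T R) J (1 ⊗ T R)ᴴ`, which is `J` because `J` is supported on
`X ⊗ A ⊗ supp σ` (`exists_choi_of_marginal`). The kind of Alice's systems plays no role, since
typed channels may be dephased at no cost (`Scenario.isFree_of_commonCause`).

* A channel realized by a common cause in a GPT is nonsignaling: discarding Alice's output discards
  all of her processing, by causality, and the embedding of quantum theory is faithful
  (`Scenario.nonsignalingAliceToBob_of_realizes`).
* The typed channels that are nonsignaling form a compact set, since entries of Choi matrices of
  channels are bounded by one; games are continuous, so the maximum over the LOSE-free channels
  exists (`exists_isOptimalQuantumScore`).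
* LOSE transformations of resources yield typed nonsignaling, hence LOSE-free, channels
  (`LOSETransformation.nonsignalingAliceToBob_apply`). Conversely each LOSE-free channel is
  generated from any resource, by ignoring that resource (`exists_apply_eq_of_isFree`).
-/

namespace LOSE

open CategoryTheory MonoidalCategory
open scoped ComplexOrder

/-! ### Common causes in a symmetric monoidal category -/

section SymmetricMonoidal

variable {C : Type u} [Category.{v} C] [MonoidalCategory C] [SymmetricCategory C]

theorem tensorHom_comp_commonCause {X Y X' Y' A B S S' : C} (a : X' ⟶ X) (b : Y' ⟶ Y)
    (s : 𝟙_ C ⟶ S ⊗ S') (f : X ⊗ S ⟶ A) (g : Y ⊗ S' ⟶ B) :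
    (a ⊗ₘ b) ≫ commonCause s f g = commonCause s ((a ▷ S) ≫ f) ((b ▷ S') ≫ g) := by
  rw [commonCause, commonCause, ← tensorHom_comp_tensorHom, ← tensorμ_natural_left_assoc,
    whisker_exchange_assoc, ← rightUnitor_inv_naturality_assoc]

theorem commonCause_comp_tensorHom {X Y A B A' B' S S' : C} (s : 𝟙_ C ⟶ S ⊗ S')
    (f : X ⊗ S ⟶ A) (g : Y ⊗ S' ⟶ B) (a : A ⟶ A') (b : B ⟶ B') :
    commonCause s f g ≫ (a ⊗ₘ b) = commonCause s (f ≫ a) (g ≫ b) := by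
  simp only [commonCause, Category.assoc, tensorHom_comp_tensorHom]

/-- If every system has at most one process to the system `T` of Alice's output, then her input is
immaterial: `(a ▷ S) ≫ f ≫ t` is the same process for every `a`. -/
theorem whiskerRight_comp_commonCause_of_subsingleton {X X' Y A T B S S' : C}
    (hT : ∀ (Z : C) (h h' : Z ⟶ T), h = h')
    (a a' : X' ⟶ X) (s : 𝟙_ C ⟶ S ⊗ S') (f : X ⊗ S ⟶ A) (g : Y ⊗ S' ⟶ B) (t : A ⟶ T) :
    (a ▷ Y) ≫ commonCause s f g ≫ (t ▷ B) = (a' ▷ Y) ≫ commonCause s f g ≫ (t ▷ B) := by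
  simp only [← tensorHom_id, commonCause_comp_tensorHom, tensorHom_comp_commonCause]
  rw [hT _ ((a ⊗ₘ 𝟙 S) ≫ f ≫ t) ((a' ⊗ₘ 𝟙 S) ≫ f ≫ t)]

/-- In a symmetric, rather than braided, category the middle-four interchange is its own inverse. -/
theorem tensorμ_eq_tensorδ (X₁ X₂ Y₁ Y₂ : C) :
    tensorμ X₁ Y₁ X₂ Y₂ = tensorδ X₁ X₂ Y₁ Y₂ := by
  simp only [tensorμ, tensorδ, SymmetricCategory.braiding_swap_eq_inv_braiding]

end SymmetricMonoidal

/-! ### Causality, dephasing and state preparation -/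

/-- Quantum theory is causal: trace preservation leaves only the trace. -/
theorem eq_discard {X : QSys} (f : X ⟶ 𝟙_ QSys) : f = discard X := by
  apply Channel.ext
  apply LinearMap.ext
  intro M
  ext i j
  have h := f.tp M
  have h' := (discard X).tp M
  rw [← h'] at h
  exact (Fintype.sum_unique (ι := PUnit) fun i => f.map M i i).symm.trans
    (h.trans (Fintype.sum_unique (ι := PUnit) _))

theorem toUnit_eq {X : QSys} (f g : X ⟶ 𝟙_ QSys) : f = g :=
  (eq_discard f).trans (eq_discard g).symm

theorem dephase_comp_dephase (X : QSys) : dephase X ≫ dephase X = dephase X := by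
  apply Channel.ext
  apply LinearMap.ext
  intro M
  change diagonalMap X (diagonalMap X M) = diagonalMap X M
  simp [diagonalMap]

theorem System.proj_comp_proj (X : System) : X.proj ≫ X.proj = X.proj := by
  obtain ⟨X, k, hk⟩ := X
  cases k
  · rfl
  · exact dephase_comp_dephase X
  · rfl

open scoped Kronecker in
/-- The preparation of a density matrix, as a process from the trivial system. -/
def prepare {X : QSys} (ρ : X.Op) (hρ : ρ.PosSemidef) (htr : ρ.trace = 1) : 𝟙_ QSys ⟶ X where
  map :=
    { toFun := fun M => M PUnit.unit PUnit.unit • ρ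
      map_add' := fun _ _ => add_smul _ _ _
      map_smul' := fun _ _ => mul_smul _ _ _ }
  cp := by
    intro κ _ M hM
    have h : ampliation (X := 𝟙_ QSys) (Y := X)
        { toFun := fun M => M PUnit.unit PUnit.unit • ρ
          map_add' := fun _ _ => add_smul _ _ _
          map_smul' := fun _ _ => mul_smul _ _ _ } M =
        ρ ⊗ₖ M.submatrix (fun p : κ => (PUnit.unit, p)) fun p => (PUnit.unit, p) := by
      ext p q
      exact mul_comm _ _
    rw [h]
    exact hρ.kronecker (hM.submatrix _)
  tp := fun M => by
    refine (Matrix.trace_smul _ _).trans ?_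
    rw [htr, smul_eq_mul, mul_one]
    exact (Fintype.sum_unique (ι := PUnit) fun i => M i i).symm

theorem posSemidef_single (X : QSys) (x : X.carrier) :
    (Matrix.single x x (1 : ℂ)).PosSemidef := by
  rw [← Matrix.diagonal_single]
  exact Matrix.PosSemidef.diagonal (Pi.single_nonneg.2 zero_le_one)

/-- The preparation of a fixed basis state of a system. -/
noncomputable def someState (X : QSys) : 𝟙_ QSys ⟶ X :=
  prepare (Matrix.single (Classical.arbitrary _) (Classical.arbitrary _) 1)
    (posSemidef_single X _) (Matrix.trace_single_eq_same _ _)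

theorem someState_comp_proj (X : System) : someState X.sys ≫ X.proj = someState X.sys := by
  obtain ⟨X, k, hk⟩ := X
  cases k
  · rfl
  · apply Channel.ext
    apply LinearMap.ext
    intro M
    change diagonalMap X (M PUnit.unit PUnit.unit • Matrix.single _ _ 1) =
      M PUnit.unit PUnit.unit • Matrix.single _ _ 1
    rw [map_smul]
    congr 1
    change Matrix.diagonal (Matrix.single _ _ 1).diag = _
    rw [Matrix.diag_single_same, Matrix.diagonal_single]
  · rfl

theorem discard_comp_someState_comp_discard (X : QSys) :
    (discard X ≫ someState X) ≫ discard X = discard X := toUnit_eq _ _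

/-! ### Nonsignaling and LOSE-free channels -/

/-- A channel is nonsignaling from Alice to Bob if and only if Bob's marginal output is unchanged
when Alice's input is replaced by a fixed state. In this form the condition is a linear equation
in the channel. -/
theorem Scenario.nonsignalingAliceToBob_iff (P : Scenario) (E : P.Chan) :
    P.NonsignalingAliceToBob E ↔
      ((discard P.X.sys ≫ someState P.X.sys) ▷ P.Y.sys) ≫ E ≫ (discard P.A.sys ▷ P.B.sys) =
        E ≫ (discard P.A.sys ▷ P.B.sys) := by
  constructor
  · rintro ⟨F, hF⟩
    rw [hF, ← comp_whiskerRight_assoc, discard_comp_someState_comp_discard]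
  · intro h
    refine ⟨(λ_ _).inv ≫ (someState P.X.sys ▷ P.Y.sys) ≫ E ≫ (discard P.A.sys ▷ P.B.sys) ≫
      (λ_ _).hom, ?_⟩
    rw [← h]
    simp

/-- Common causes of a GPT do not signal: causality of the GPT makes Alice's input immaterial once
her output is discarded, and faithfulness of the embedding brings this back to quantum theory. -/
theorem Scenario.nonsignalingAliceToBob_of_realizes {𝒢 : GPT.{u, v}} {P : Scenario} {E : P.Chan}
    (h : 𝒢.Realizes E) : P.NonsignalingAliceToBob E := by
  rw [Scenario.nonsignalingAliceToBob_iff]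
  obtain ⟨S, S', s, f, g, h⟩ := h
  -- The image of the trivial system is isomorphic to the unit, hence terminal.
  have hT : ∀ (Z : 𝒢.Sys) (k k' : Z ⟶ 𝒢.quantum.obj (𝟙_ QSys)), k = k' := by
    intro Z k k'
    rw [← cancel_mono (Functor.Monoidal.εIso 𝒢.quantum).inv]
    exact 𝒢.causal.hom_ext _ _
  apply 𝒢.quantum.map_injective
  rw [← cancel_epi (Functor.LaxMonoidal.μ 𝒢.quantum P.X.sys P.Y.sys)]
  have key : Functor.LaxMonoidal.μ 𝒢.quantum P.X.sys P.Y.sys ≫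
      𝒢.quantum.map (E ≫ (discard P.A.sys ▷ P.B.sys)) =
      commonCause s f g ≫ (𝒢.quantum.map (discard P.A.sys) ▷ _) ≫ Functor.LaxMonoidal.μ _ _ _ := by
    rw [Functor.map_comp, reassoc_of% h, Functor.LaxMonoidal.μ_natural_left]
  rw [key, Functor.map_comp, ← Functor.LaxMonoidal.μ_natural_left_assoc, key]
  have := whiskerRight_comp_commonCause_of_subsingleton hT
    (𝒢.quantum.map (discard P.X.sys ≫ someState P.X.sys)) (𝟙 _) s f g
    (𝒢.quantum.map (discard P.A.sys))
  simp only [id_whiskerRight, Category.id_comp] at this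
  rw [reassoc_of% this]

/-- A channel of the scenario that is obtained from a shared state by arbitrary local channels is
LOSE-free, since the local channels may be dephased. -/
theorem Scenario.isFree_of_commonCause {P : Scenario} {S S' : QSys} (s : 𝟙_ QSys ⟶ S ⊗ S')
    (f : P.X.sys ⊗ S ⟶ P.A.sys) (g : P.Y.sys ⊗ S' ⟶ P.B.sys)
    (h : P.Typed (commonCause s f g)) : P.IsFree (commonCause s f g) := by
  refine ⟨S, S', s, (P.X.proj ▷ S) ≫ f ≫ P.A.proj, (P.Y.proj ▷ S') ≫ g ≫ P.B.proj, ?_, ?_, ?_⟩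
  · simp only [Category.assoc, System.proj_comp_proj]
    rw [← comp_whiskerRight_assoc, System.proj_comp_proj]
  · simp only [Category.assoc, System.proj_comp_proj]
    rw [← comp_whiskerRight_assoc, System.proj_comp_proj]
  · rw [← tensorHom_comp_commonCause, ← commonCause_comp_tensorHom]
    exact h

theorem Scenario.typed_of_isFree {P : Scenario} {E : P.Chan} (h : P.IsFree E) : P.Typed E := by
  obtain ⟨S, S', s, f, g, hf, hg, rfl⟩ := h
  rw [Scenario.Typed, commonCause_comp_tensorHom, tensorHom_comp_commonCause, hf, hg]

theorem Scenario.nonsignalingAliceToBob_of_isFree {P : Scenario} {E : P.Chan} (h : P.IsFree E) :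
    P.NonsignalingAliceToBob E := by
  rw [Scenario.nonsignalingAliceToBob_iff]
  obtain ⟨S, S', s, f, g, hf, hg, rfl⟩ := h
  have := whiskerRight_comp_commonCause_of_subsingleton (fun _ => toUnit_eq)
    (discard P.X.sys ≫ someState P.X.sys) (𝟙 _) s f g (discard P.A.sys)
  rwa [id_whiskerRight, Category.id_comp] at this

theorem Scenario.exists_isFree (P : Scenario) : ∃ E : P.Chan, P.IsFree E := by
  -- Both parties discard their inputs and prepare a basis state.
  refine ⟨commonCause (S := 𝟙_ QSys) (S' := 𝟙_ QSys) (λ_ _).inv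
    (discard _ ≫ someState P.A.sys) (discard _ ≫ someState P.B.sys), _, _, _, _, _, ?_, ?_, rfl⟩
  · rw [Category.assoc, someState_comp_proj, ← Category.assoc]
    exact congrArg (· ≫ _) (toUnit_eq _ _)
  · rw [Category.assoc, someState_comp_proj, ← Category.assoc]
    exact congrArg (· ≫ _) (toUnit_eq _ _)

/-! ### LOSE transformations -/

theorem LOSETransformation.typed_apply {P R : Scenario} (τ : LOSETransformation P R)
    (E : P.Chan) : R.Typed (τ.apply E) := by
  have hA : (R.X.proj ▷ τ.SA) ≫ τ.preA = τ.preA := by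
    rw [← τ.preA_typed, ← comp_whiskerRight_assoc, System.proj_comp_proj]
  have hB : (R.Y.proj ▷ τ.SB) ≫ τ.preB = τ.preB := by
    rw [← τ.preB_typed, ← comp_whiskerRight_assoc, System.proj_comp_proj]
  have hA' : τ.postA ≫ R.A.proj = τ.postA := by
    rw [← τ.postA_typed]; simp [System.proj_comp_proj]
  have hB' : τ.postB ≫ R.B.proj = τ.postB := by
    rw [← τ.postB_typed]; simp [System.proj_comp_proj]
  simp only [Scenario.Typed, apply, Category.assoc, tensorHom_comp_tensorHom, hA', hB']
  rw [← Category.assoc, tensorHom_comp_commonCause, hA, hB]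

/-- LOSE transformations preserve nonsignaling: once Alice's output is discarded, so is everything
else on her side. -/
theorem LOSETransformation.nonsignalingAliceToBob_apply {P R : Scenario}
    (τ : LOSETransformation P R) {E : P.Chan} (h : P.NonsignalingAliceToBob E) :
    R.NonsignalingAliceToBob (τ.apply E) := by
  rw [Scenario.nonsignalingAliceToBob_iff]
  obtain ⟨F, hF⟩ := h
  -- By causality, discarding Alice's final output discards her output of `E` and her memory.
  have h1 : τ.postA ≫ discard R.A.sys =
      (discard P.A.sys ⊗ₘ discard τ.MA) ≫ (λ_ (𝟙_ QSys)).hom := toUnit_eq _ _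
  have key : τ.apply E ≫ (discard R.A.sys ▷ R.B.sys) =
      commonCause τ.state τ.preA τ.preB ≫ ((discard P.X.sys ⊗ₘ discard τ.MA) ▷ _) ≫
        tensorμ _ _ _ _ ≫ ((𝟙_ QSys ◁ F) ▷ (𝟙_ QSys ⊗ τ.MB)) ≫ tensorμ _ _ _ _ ≫
          ((λ_ (𝟙_ QSys)).hom ⊗ₘ τ.postB) := by
    have h3 : (discard P.X.sys ⊗ₘ discard τ.MA) ▷ (P.Y.sys ⊗ τ.MB) =
      (discard P.X.sys ⊗ₘ discard τ.MA) ⊗ₘ (𝟙 P.Y.sys ⊗ₘ 𝟙 τ.MB) := by simp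
    have h4 : (τ.postA ⊗ₘ τ.postB) ≫ (discard R.A.sys ▷ R.B.sys) =
        ((discard P.A.sys ⊗ₘ discard τ.MA) ⊗ₘ (𝟙 P.B.sys ⊗ₘ 𝟙 τ.MB)) ≫
          ((λ_ (𝟙_ QSys)).hom ⊗ₘ τ.postB) := by
      rw [← tensorHom_id, tensorHom_comp_tensorHom, h1, tensorHom_comp_tensorHom]; simp
    simp only [apply, Category.assoc]
    rw [h4, h3, ← tensorμ_natural_assoc (discard P.A.sys)]
    -- Nonsignaling of `E` moves the discarding from its output to its input.
    have h5 : (E ▷ (τ.MA ⊗ τ.MB)) ≫ ((discard P.A.sys ⊗ₘ 𝟙 P.B.sys) ⊗ₘ (discard τ.MA ⊗ₘ 𝟙 τ.MB)) =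
      ((discard P.X.sys ⊗ₘ 𝟙 P.Y.sys) ⊗ₘ (discard τ.MA ⊗ₘ 𝟙 τ.MB)) ≫
        ((𝟙_ QSys ◁ F) ▷ (𝟙_ QSys ⊗ τ.MB)) := by
      rw [← tensorHom_id, tensorHom_comp_tensorHom, ← tensorHom_id, tensorHom_comp_tensorHom,
        tensorHom_id, hF, tensorHom_id]; simp
    rw [reassoc_of% h5, ← tensorμ_natural_assoc (discard P.X.sys)]
  rw [key]
  have := whiskerRight_comp_commonCause_of_subsingleton (T := 𝟙_ QSys)
    (fun _ => toUnit_eq)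
    (discard R.X.sys ≫ someState R.X.sys) (𝟙 _) τ.state τ.preA τ.preB
    ((discard P.X.sys ⊗ₘ discard τ.MA) ≫ (λ_ (𝟙_ QSys)).hom)
  rw [id_whiskerRight, Category.id_comp, comp_whiskerRight (_ ⊗ₘ _), ← Category.assoc,
    ← Category.assoc, ← Category.assoc, cancel_mono, Category.assoc] at this
  rw [reassoc_of% this]

/-- Every LOSE-free channel is generated from every channel `E`, by a LOSE transformation that
feeds fixed states to `E` and discards its outputs. -/
theorem exists_apply_eq_of_isFree {P R : Scenario} (E : P.Chan) {E' : R.Chan} (h : R.IsFree E') :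
    ∃ τ : LOSETransformation P R, τ.apply E = E' := by
  obtain ⟨S, S', s, f, g, hf, hg, rfl⟩ := h
  have hf1 : (R.X.proj ▷ S) ≫ f = f := by
    rw [← hf, ← comp_whiskerRight_assoc, System.proj_comp_proj]
  have hg1 : (R.Y.proj ▷ S') ≫ g = g := by
    rw [← hg, ← comp_whiskerRight_assoc, System.proj_comp_proj]
  have hf2 : f ≫ R.A.proj = f := by
    rw [← hf]; simp [System.proj_comp_proj]
  have hg2 : g ≫ R.B.proj = g := by
    rw [← hg]; simp [System.proj_comp_proj]
  have hpre : ∀ (U : System) (M : QSys), ((λ_ M).inv ≫ (someState U.sys ▷ M)) ≫ (U.proj ▷ M) =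
      (λ_ M).inv ≫ (someState U.sys ▷ M) := by
    intro U M
    rw [Category.assoc, ← comp_whiskerRight, someState_comp_proj]
  have hpost : ∀ (U V : System), (U.proj ▷ V.sys) ≫
      ((discard U.sys ▷ V.sys) ≫ (λ_ V.sys).hom ≫ V.proj) ≫ V.proj =
      (discard U.sys ▷ V.sys) ≫ (λ_ V.sys).hom ≫ V.proj := by
    intro U V
    simp only [Category.assoc, System.proj_comp_proj]
    rw [← comp_whiskerRight_assoc, toUnit_eq (U.proj ≫ discard U.sys) (discard U.sys)]
  refine ⟨
    { SA := S, SB := S', MA := R.A.sys, MB := R.B.sys, state := s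
      preA := f ≫ (λ_ _).inv ≫ (someState P.X.sys ▷ _)
      preB := g ≫ (λ_ _).inv ≫ (someState P.Y.sys ▷ _)
      postA := (discard P.A.sys ▷ _) ≫ (λ_ _).hom ≫ R.A.proj
      postB := (discard P.B.sys ▷ _) ≫ (λ_ _).hom ≫ R.B.proj
      preA_typed := ?_
      preB_typed := ?_
      postA_typed := hpost _ _
      postB_typed := hpost _ _ }, ?_⟩
  · rw [TypedLocal, Category.assoc, hpre, reassoc_of% hf1]
  · rw [TypedLocal, Category.assoc, hpre, reassoc_of% hg1]
  · simp only [LOSETransformation.apply]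
    have h0 : (discard P.A.sys ▷ R.A.sys ≫ (λ_ R.A.sys).hom ≫ R.A.proj ⊗ₘ
        discard P.B.sys ▷ R.B.sys ≫ (λ_ R.B.sys).hom ≫ R.B.proj) =
        ((discard P.A.sys ▷ R.A.sys) ⊗ₘ (discard P.B.sys ▷ R.B.sys)) ≫
          ((λ_ R.A.sys).hom ⊗ₘ (λ_ R.B.sys).hom) ≫ (R.A.proj ⊗ₘ R.B.proj) := by
      simp only [tensorHom_comp_tensorHom]
    have h1 := tensorμ_natural (someState P.X.sys) (𝟙 R.A.sys) (someState P.Y.sys) (𝟙 R.B.sys)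
    have h2 := tensorμ_natural_left (discard P.A.sys) (discard P.B.sys) R.A.sys R.B.sys
    -- The resource `E` drops out, since it is fed fixed states and its outputs are discarded.
    have h3 : (someState P.X.sys ⊗ₘ someState P.Y.sys) ≫ E ≫
        (discard P.A.sys ⊗ₘ discard P.B.sys) = 𝟙 (𝟙_ QSys ⊗ 𝟙_ QSys) := by
      rw [← cancel_mono (λ_ (𝟙_ QSys)).hom]
      exact toUnit_eq _ _
    have h4 : ((λ_ R.A.sys).inv ⊗ₘ (λ_ R.B.sys).inv) ≫ tensorμ _ _ _ _ ≫ tensorμ _ _ _ _ ≫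
        ((λ_ R.A.sys).hom ⊗ₘ (λ_ R.B.sys).hom) = 𝟙 (R.A.sys ⊗ R.B.sys) :=
by
      rw [tensorμ_eq_tensorδ, tensorδ_tensorμ_assoc, tensorHom_comp_tensorHom]
      simp
    simp only [tensorHom_id, id_whiskerRight] at h1
    rw [← commonCause_comp_tensorHom, ← tensorHom_comp_tensorHom, h0]
    simp only [Category.assoc]
    rw [← reassoc_of% h2, reassoc_of% h1]
    rw [← comp_whiskerRight_assoc, ← comp_whiskerRight_assoc, Category.assoc, h3, id_whiskerRight,
      Category.id_comp, reassoc_of% h4, commonCause_comp_tensorHom, hf2, hg2]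

/-! ### Positive semidefinite matrices -/

section Matrices

open Matrix
open scoped Kronecker

/-- A square root `T` of a positive semidefinite matrix together with a pseudoinverse `R`, such
that `R * T` is an orthogonal projection. -/
theorem exists_sqrt_pseudoinverse {n : Type*} [Fintype n] [DecidableEq n] {A : Matrix n n ℂ}
    (hA : A.PosSemidef) :
    ∃ T R : Matrix n n ℂ, T * Tᴴ = A ∧ (R * T)ᴴ = R * T ∧ R * T * (R * T) = R * T ∧
      T * (R * T) = T := by
  obtain ⟨U, d, hU, hd, rfl⟩ : ∃ (U : Matrix n n ℂ) (d : n → ℝ), Uᴴ * U = 1 ∧ (∀ i, 0 ≤ d i) ∧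
      A = U * diagonal (fun i => (d i : ℂ)) * Uᴴ := by
    refine ⟨hA.1.eigenvectorUnitary, hA.1.eigenvalues, Unitary.coe_star_mul_self _,
      hA.eigenvalues_nonneg, ?_⟩
    conv_lhs => rw [hA.1.spectral_theorem, Unitary.conjStarAlgAut_apply]
    rfl
  have hRT : diagonal (fun i => ((√(d i))⁻¹ : ℂ)) * Uᴴ * (U * diagonal fun i => (√(d i) : ℂ)) =
      diagonal fun i => if d i = 0 then 0 else 1 := by
    rw [Matrix.mul_assoc, ← Matrix.mul_assoc Uᴴ, hU, Matrix.one_mul, diagonal_mul_diagonal]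
    congr 1
    ext i
    by_cases h : d i = 0
    · simp [h]
    · rw [if_neg h]
      have : √(d i) ≠ 0 := fun h' => h ((Real.sqrt_eq_zero (hd i)).1 h')
      exact inv_mul_cancel₀ (by exact_mod_cast this)
  refine ⟨U * diagonal fun i => (√(d i) : ℂ), diagonal (fun i => ((√(d i))⁻¹ : ℂ)) * Uᴴ,
    ?_, ?_, ?_, ?_⟩
  · rw [conjTranspose_mul, diagonal_conjTranspose, Matrix.mul_assoc, ← Matrix.mul_assoc (diagonal _),
      diagonal_mul_diagonal, ← Matrix.mul_assoc]
    congr 3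
    ext i
    simp only [Pi.star_apply, RCLike.star_def, Complex.conj_ofReal]
    exact_mod_cast Real.mul_self_sqrt (hd i)
  · rw [hRT, diagonal_conjTranspose]
    congr 1
    ext i
    simp only [Pi.star_apply]
    split_ifs <;> simp
  · rw [hRT, diagonal_mul_diagonal]
    congr 1
    ext i
    split_ifs <;> simp
  · rw [hRT, Matrix.mul_assoc, diagonal_mul_diagonal]
    congr 2
    ext i
    split_ifs with h <;> simp [h]

/-- If a compression of a positive semidefinite matrix has trace zero, then already one-sided
multiplication annihilates the matrix. -/
theorem mul_eq_zero_of_trace_eq_zero {m n : Type*} [Fintype m] [Fintype n]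
    {J : Matrix n n ℂ} (hJ : J.PosSemidef) {N : Matrix m n ℂ} (h : (N * J * Nᴴ).trace = 0) :
    N * J = 0 := by
  classical
  obtain ⟨V, -, rfl, -⟩ := exists_sqrt_pseudoinverse hJ
  have h' : (N * V * (N * V)ᴴ).trace = 0 := by
    rw [conjTranspose_mul, ← h]; simp only [Matrix.mul_assoc]
  rw [trace_mul_conjTranspose_self_eq_zero_iff] at h'
  rw [← Matrix.mul_assoc, h', Matrix.zero_mul]

/-- Summing a positive semidefinite matrix over a common tensor factor. -/
theorem posSemidef_sum_sum {ι κ : Type*} [Fintype ι] [Fintype κ]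
    {N : Matrix (ι × κ) (ι × κ) ℂ} (hN : N.PosSemidef) :
    (of fun p q => ∑ x, ∑ x', N (x, p) (x', q)).PosSemidef := by
  classical
  have h := hN.conjTranspose_mul_mul_same
    (of fun (i : ι × κ) (q : κ) => if i.2 = q then (1 : ℂ) else 0)
  refine Eq.subst (motive := Matrix.PosSemidef) ?_ h
  ext p q
  simp only [mul_apply, conjTranspose_apply, of_apply, Fintype.sum_prod_type, apply_ite star,
    star_one, star_zero, ite_mul, mul_ite, one_mul, mul_one, zero_mul, mul_zero,
    Finset.sum_ite_eq', Finset.mem_univ, if_true]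
  exact Finset.sum_comm

theorem one_kronecker_conj_apply {m n k : Type*} [Fintype m] [Fintype n] [DecidableEq m]
    (R : Matrix k n ℂ) (J : Matrix (m × n) (m × n) ℂ) (i i' : m) (s s' : k) :
    ((1 : Matrix m m ℂ) ⊗ₖ R * J * ((1 : Matrix m m ℂ) ⊗ₖ R)ᴴ) (i, s) (i', s') =
      (R * (of fun b b' => J (i, b) (i', b')) * Rᴴ) s s' := by
  simp only [mul_apply, conjTranspose_apply, kroneckerMap_apply, one_apply, of_apply,
    Fintype.sum_prod_type, ite_mul, one_mul, zero_mul, apply_ite star, star_zero, mul_ite,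
    mul_zero, Finset.sum_ite_irrel, Finset.sum_const_zero, Finset.sum_ite_eq, Finset.mem_univ,
    if_true]

end Matrices

/-! ### Channels from Choi matrices -/

section Choi

open Matrix
open scoped Kronecker

/-- The linear map on operators with Choi matrix `K`, that is, with
`K (x, a) (x', a') = f (|x⟩⟨x'|) a a'`. -/
def choiMap {X A : QSys} (K : (X.tensor A).Op) : X.Op →ₗ[ℂ] A.Op where
  toFun M := of fun a a' => ∑ x, ∑ x', M x x' * K (x, a) (x', a')
  map_add' M N := by
    ext a a'
    simp [add_mul, Finset.sum_add_distrib]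
  map_smul' c M := by
    ext a a'
    simp [mul_assoc, Finset.mul_sum]

theorem choiMap_cp {X A : QSys} {K : (X.tensor A).Op} (hK : K.PosSemidef) :
    IsCompletelyPositive (choiMap K) := by
  intro κ _ M hM
  have h := posSemidef_sum_sum ((hM.kronecker hK).submatrix
    fun p : X.carrier × A.carrier × κ => ((p.1, p.2.2), (p.1, p.2.1)))
  refine Eq.subst (motive := Matrix.PosSemidef) ?_ h
  ext p q
  simp only [ampliation, choiMap, of_apply, submatrix_apply, kroneckerMap_apply,
    LinearMap.coe_mk, AddHom.coe_mk]

/-- The channel with a given Choi matrix. -/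
def choiChannel {X A : QSys} (K : (X.tensor A).Op) (hK : K.PosSemidef)
    (htp : ∀ x x', ∑ a, K (x, a) (x', a) = if x = x' then 1 else 0) : X ⟶ A where
  map := choiMap K
  cp := choiMap_cp hK
  tp M := by
    change ∑ a, ∑ x, ∑ x', M x x' * K (x, a) (x', a) = M.trace
    rw [Finset.sum_comm]
    refine Finset.sum_congr rfl fun x _ => ?_
    rw [Finset.sum_comm]
    simp only [← Finset.mul_sum, htp]
    simp

/-- The Choi matrix of a completely positive map is positive semidefinite. -/
theorem posSemidef_choi {X A : QSys} {f : X.Op →ₗ[ℂ] A.Op} (hf : IsCompletelyPositive f) :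
    (of fun p q : X.carrier × A.carrier =>
      f (single p.1 q.1 1) p.2 q.2).PosSemidef := by
  -- The Choi matrix is the image of the unnormalized maximally entangled state.
  have h := hf X.carrier _ (posSemidef_vecMulVec_self_star
    fun p : X.carrier × X.carrier => if p.1 = p.2 then (1 : ℂ) else 0)
  refine Eq.subst (motive := Matrix.PosSemidef) ?_
    (h.submatrix fun p : X.carrier × A.carrier => (p.2, p.1))
  ext p q
  simp only [ampliation, submatrix_apply, of_apply]
  refine congrArg (fun N => f N p.2 q.2) ?_
  ext x x'
  simp only [of_apply, vecMulVec_apply, Pi.star_apply, single_apply]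
  by_cases h1 : x = p.1 <;> by_cases h2 : x' = q.1 <;> simp [h1, h2, Ne.symm]

theorem map_apply_eq_sum {X A : QSys} (f : X.Op →ₗ[ℂ] A.Op) (M : X.Op) (a a' : A.carrier) :
    f M a a' = ∑ x, ∑ x', M x x' * f (single x x' 1) a a' := by
  conv_lhs => rw [matrix_eq_sum_single M]
  simp only [map_sum, Matrix.sum_apply]
  refine Finset.sum_congr rfl fun x _ => Finset.sum_congr rfl fun x' _ => ?_
  have : single x x' (M x x') = M x x' • single x x' (1 : ℂ) := by simp [smul_single]
  rw [this, map_smul]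
  rfl

/-- The action of the common-cause process whose state has density matrix `ρ`. -/
theorem commonCause_prepare_map_apply {X Y A B S S' : QSys} (ρ : (S.tensor S').Op)
    (hρ : ρ.PosSemidef) (htr : ρ.trace = 1) (f : X ⊗ S ⟶ A) (g : Y ⊗ S' ⟶ B)
    (M : (X.tensor Y).Op) (p q : A.carrier × B.carrier) :
    Channel.map (commonCause (S := S) (S' := S') (prepare (X := S.tensor S') ρ hρ htr) f g) M p q =
      Channel.map f (of fun i i' => Channel.map g (of fun j j' =>
        M (i.1, j.1) (i'.1, j'.1) * ρ (i.2, j.2) (i'.2, j'.2)) p.2 q.2) p.1 q.1 := by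
  rfl

end Choi

/-! ### Channels without input on one side -/

section Steering

open Matrix
open scoped Kronecker

/-- A Choi matrix whose marginal is `1 ⊗ σ` arises from the Choi matrix `K` of a channel by
applying a square root `T` of `σ`. -/
theorem exists_choi_of_marginal {X A B : Type*} [Fintype X] [DecidableEq X] [Nonempty X]
    [Fintype A] [DecidableEq A] [Nonempty A] [Fintype B] [DecidableEq B]
    {J : Matrix ((X × A) × B) ((X × A) × B) ℂ} (hJ : J.PosSemidef) {σ : Matrix B B ℂ}
    (hσ : ∀ x x' b b', ∑ a, J ((x, a), b) ((x', a), b') = if x = x' then σ b b' else 0) :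
    ∃ (T : Matrix B B ℂ) (K : Matrix ((X × A) × B) ((X × A) × B) ℂ), T * Tᴴ = σ ∧
      K.PosSemidef ∧
      (∀ x x' s s', ∑ a, K ((x, a), s) ((x', a), s') = if x = x' ∧ s = s' then 1 else 0) ∧
      (1 : Matrix (X × A) (X × A) ℂ) ⊗ₖ T * K * ((1 : Matrix (X × A) (X × A) ℂ) ⊗ₖ T)ᴴ = J := by
  have hσ' : σ.PosSemidef := by
    have x : X := Classical.arbitrary X
    have h := posSemidef_sum Finset.univ fun (a : A) _ => hJ.submatrix fun b : B => ((x, a), b)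
    refine Eq.subst (motive := Matrix.PosSemidef) ?_ h
    ext b b'
    rw [Matrix.sum_apply]
    simpa using hσ x x b b'
  obtain ⟨T, R, hT, hRT, hRT2, hTRT⟩ := exists_sqrt_pseudoinverse hσ'
  -- The marginal of a locally compressed Choi matrix.
  have hmarg : ∀ (L : Matrix B B ℂ) x x' s s',
      ∑ a, ((1 : Matrix (X × A) (X × A) ℂ) ⊗ₖ L * J * ((1 : Matrix (X × A) (X × A) ℂ) ⊗ₖ L)ᴴ)
        ((x, a), s) ((x', a), s') = if x = x' then (L * T * (L * T)ᴴ) s s' else 0 := by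
    intro L x x' s s'
    simp only [one_kronecker_conj_apply]
    rw [← Matrix.sum_apply, ← Matrix.sum_mul, ← Matrix.mul_sum]
    have : ∑ a, (of fun b b' => J ((x, a), b) ((x', a), b')) = if x = x' then σ else 0 := by
      ext b b'
      rw [Matrix.sum_apply]
      simp only [of_apply, hσ]
      split_ifs <;> rfl
    rw [this]
    split_ifs
    · rw [← hT, conjTranspose_mul]
      simp only [Matrix.mul_assoc]
    · simp
  -- `J` is supported where `σ` is, since its compression to the kernel of `σ` has trace zero.
  have hsupp : (1 : Matrix (X × A) (X × A) ℂ) ⊗ₖ (1 - T * R) * J = 0 := by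
    apply mul_eq_zero_of_trace_eq_zero hJ
    have h0 : (1 - T * R) * T = 0 := by
      rw [Matrix.sub_mul, Matrix.one_mul, Matrix.mul_assoc, hTRT, sub_self]
    simp only [trace, diag_apply]
    rw [Fintype.sum_prod_type_right]
    refine Finset.sum_eq_zero fun s _ => ?_
    rw [Fintype.sum_prod_type]
    refine Finset.sum_eq_zero fun x _ => ?_
    rw [hmarg, h0]
    simp
  have hTR : (1 : Matrix (X × A) (X × A) ℂ) ⊗ₖ (T * R) * J = J := by
    have : (1 : Matrix (X × A) (X × A) ℂ) ⊗ₖ (T * R) =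
        1 - (1 : Matrix (X × A) (X × A) ℂ) ⊗ₖ (1 - T * R) := by
      rw [eq_sub_iff_add_eq, ← Matrix.kronecker_add, add_sub_cancel, Matrix.one_kronecker_one]
    rw [this, Matrix.sub_mul, hsupp, sub_zero, Matrix.one_mul]
  have hTR' : J * ((1 : Matrix (X × A) (X × A) ℂ) ⊗ₖ (T * R))ᴴ = J := by
    conv_lhs => rw [← hJ.1.eq]
    rw [← conjTranspose_mul, hTR, hJ.1.eq]
  -- On the kernel of `R * T`, which the state does not reach, `K` prepares a fixed state.
  let D : Matrix (X × A) (X × A) ℂ :=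
    diagonal fun i => if i.2 = Classical.arbitrary A then 1 else 0
  have hD : D.PosSemidef := PosSemidef.diagonal fun i => by
    dsimp only [Pi.zero_apply]; split_ifs <;> simp
  have hQ : (1 - R * T).PosSemidef := by
    have : (1 - R * T)ᴴ * (1 - R * T) = 1 - R * T := by
      rw [conjTranspose_sub, conjTranspose_one, hRT, Matrix.sub_mul, Matrix.one_mul,
        Matrix.mul_sub, hRT2, Matrix.mul_one, sub_self, sub_zero]
    exact this ▸ posSemidef_conjTranspose_mul_self _
  refine ⟨T, (1 : Matrix (X × A) (X × A) ℂ) ⊗ₖ R * J * ((1 : Matrix (X × A) (X × A) ℂ) ⊗ₖ R)ᴴ +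
    D ⊗ₖ (1 - R * T), hT, (hJ.mul_mul_conjTranspose_same _).add (hD.kronecker hQ), ?_, ?_⟩
  · intro x x' s s'
    simp only [Matrix.add_apply, Finset.sum_add_distrib, hmarg, kroneckerMap_apply]
    rw [← Finset.sum_mul, hRT, hRT2]
    by_cases hx : x = x'
    · subst hx
      simp [D, one_apply]
    · simp [D, hx]
  · rw [Matrix.mul_add, Matrix.add_mul, ← mul_kronecker_mul, Matrix.mul_sub, hTRT, Matrix.mul_one,
      sub_self, kronecker_zero, Matrix.zero_mul, add_zero]
    calc _ = ((1 : Matrix (X × A) (X × A) ℂ) ⊗ₖ T * (1 : Matrix (X × A) (X × A) ℂ) ⊗ₖ R) * J *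
          ((1 : Matrix (X × A) (X × A) ℂ) ⊗ₖ T * (1 : Matrix (X × A) (X × A) ℂ) ⊗ₖ R)ᴴ := by
          rw [conjTranspose_mul]
          simp only [Matrix.mul_assoc]
      _ = J := by rw [← mul_kronecker_mul, Matrix.one_mul, hTR, hTR']

/-- If Bob has no input, then every channel that is nonsignaling from Alice to Bob is LOSE-free:
Alice can steer the purification of Bob's marginal state. -/
theorem Scenario.isFree_of_nonsignalingAliceToBob {P : Scenario}
    (hY : Fintype.card P.Y.sys.carrier = 1) {E : P.Chan} (ht : P.Typed E)
    (hE : P.NonsignalingAliceToBob E) : P.IsFree E := by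
  obtain ⟨F, hF⟩ := hE
  obtain ⟨y₀, hy₀⟩ := Fintype.card_eq_one_iff.1 hY
  let f : (P.X.sys.tensor P.Y.sys).Op →ₗ[ℂ] (P.A.sys.tensor P.B.sys).Op := Channel.map E
  let J : Matrix ((P.X.sys.carrier × P.A.sys.carrier) × P.B.sys.carrier)
      ((P.X.sys.carrier × P.A.sys.carrier) × P.B.sys.carrier) ℂ :=
    of fun i j => f (single (i.1.1, y₀) (j.1.1, y₀) 1) (i.1.2, i.2) (j.1.2, j.2)
  have hJ : J.PosSemidef := (posSemidef_choi (f := f) (Channel.cp E)).submatrix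
    fun i : (P.X.sys.carrier × P.A.sys.carrier) × P.B.sys.carrier =>
      ((i.1.1, y₀), (i.1.2, i.2))
  let σ : P.B.sys.Op := Channel.map F (single y₀ y₀ 1)
  have hσ : ∀ x x' b b', ∑ a, J ((x, a), b) ((x', a), b') = if x = x' then σ b b' else 0 := by
    intro x x' b b'
    have h := congrArg (fun N : Matrix (PUnit × P.B.sys.carrier) (PUnit × P.B.sys.carrier) ℂ =>
      N (PUnit.unit, b) (PUnit.unit, b'))
      (LinearMap.congr_fun (congrArg Channel.map hF) (single (x, y₀) (x', y₀) 1))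
    change ∑ a, J ((x, a), b) ((x', a), b') = Channel.map F (of fun y y' =>
      ∑ z, (single (x, y₀) (x', y₀) (1 : ℂ)) (z, y) (z, y')) b b' at h
    have hs : (of fun y y' => ∑ z, (single (x, y₀) (x', y₀) (1 : ℂ)) (z, y) (z, y')) =
        if x = x' then single y₀ y₀ (1 : ℂ) else 0 := by
      ext y y'
      simp only [of_apply, hy₀ y, hy₀ y', single_apply, Prod.mk.injEq, and_true]
      by_cases hx : x = x'
      · subst hx; simp
      · rw [Finset.sum_eq_zero]
        · simp [hx]
        · intro z _
          rw [if_neg]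
          rintro ⟨rfl, rfl⟩
          exact hx rfl
    rw [h, hs]
    split_ifs
    · rfl
    · rw [map_zero]; rfl
  obtain ⟨T, K, hT, hK, hKtp, hKJ⟩ := exists_choi_of_marginal hJ hσ
  let B := P.B.sys
  -- The purification `∑ |s⟩ ⊗ T|s⟩` of `σ`, with Alice's share first.
  let ψ : B.carrier × B.carrier → ℂ := fun p => T p.2 p.1
  have htr : (vecMulVec ψ (star ψ)).trace = 1 := by
    have h1 : σ.trace = 1 := (Channel.tp F _).trans (trace_single_eq_same _ _)
    rw [← h1, ← hT]
    simp only [trace, diag_apply, vecMulVec_apply, Fintype.sum_prod_type_right, mul_apply,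
      conjTranspose_apply]
    rfl
  let e : B.carrier ≃ (P.Y.sys.tensor B).carrier :=
    { toFun := fun b => (y₀, b)
      invFun := fun p => p.2
      left_inv := fun _ => rfl
      right_inv := fun p => Prod.ext (hy₀ p.1).symm rfl }
  have hfree : commonCause (C := QSys) (S := B) (S' := B)
      (prepare (X := B.tensor B) (vecMulVec ψ (star ψ)) (posSemidef_vecMulVec_self_star ψ) htr)
      (choiChannel (X := P.X.sys.tensor B) (A := P.A.sys)
        (K.submatrix (fun p => ((p.1.1, p.2), p.1.2)) fun p => ((p.1.1, p.2), p.1.2))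
        (hK.submatrix _) (fun x x' => by
          simp only [submatrix_apply, hKtp, Prod.ext_iff]))
      (Channel.relabel e) = E := by
    apply Channel.ext
    apply LinearMap.ext
    intro M
    ext p q
    rw [commonCause_prepare_map_apply]
    have hf : Channel.map E M p q = ∑ x, ∑ x', M (x, y₀) (x', y₀) *
        J ((x, p.1), p.2) ((x', q.1), q.2) := by
      refine (map_apply_eq_sum f M p q).trans ?_
      have hsum : ∀ h : P.X.sys.carrier × P.Y.sys.carrier → ℂ, ∑ z, h z = ∑ x, h (x, y₀) := by
        intro h
        rw [Fintype.sum_prod_type]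
        refine Finset.sum_congr rfl fun x _ => ?_
        exact Fintype.sum_eq_single y₀ fun y hy => absurd (hy₀ y) hy
      rw [hsum]
      refine Finset.sum_congr rfl fun x _ => ?_
      rw [hsum]
      rfl
    rw [hf]
    change ∑ i : P.X.sys.carrier × B.carrier, ∑ i' : P.X.sys.carrier × B.carrier,
      M (i.1, y₀) (i'.1, y₀) * (T p.2 i.2 * star (T q.2 i'.2)) *
        K ((i.1, p.1), i.2) ((i'.1, q.1), i'.2) = _
    rw [← hKJ]
    simp only [one_kronecker_conj_apply]
    simp only [mul_apply, conjTranspose_apply, of_apply, Fintype.sum_prod_type]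
    refine Finset.sum_congr rfl fun x _ => ?_
    rw [Finset.sum_comm]
    refine Finset.sum_congr rfl fun x' _ => ?_
    simp only [Finset.mul_sum, Finset.sum_mul]
    rw [Finset.sum_comm]
    refine Finset.sum_congr rfl fun s' _ => Finset.sum_congr rfl fun s _ => ?_
    ring
  rw [← hfree] at ht ⊢
  exact P.isFree_of_commonCause _ _ _ ht

end Steering

/-! ### Compactness -/

section Compactness

open Matrix

theorem isClosed_posSemidef (n : Type*) [Fintype n] :
    IsClosed {M : Matrix n n ℂ | M.PosSemidef} := by
  simp only [posSemidef_iff_dotProduct_mulVec, IsHermitian, Set.ofPred_and, Set.ofPred_forall]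
  refine (isClosed_eq (by fun_prop) continuous_id).inter (isClosed_iInter fun x => ?_)
  refine isClosed_le continuous_const ?_
  fun_prop

/-- The bound follows from nonnegativity of the `2 × 2` principal minors. -/
theorem norm_apply_le_one {n : Type*} [Fintype n] {J : Matrix n n ℂ} (hJ : J.PosSemidef)
    (hd : ∀ i, J i i ≤ 1) (i j : n) : ‖J i j‖ ≤ 1 := by
  have h := (hJ.submatrix ![i, j]).det_nonneg
  have hij : J j i = star (J i j) := (hJ.1.apply j i).symm
  simp only [det_fin_two, submatrix_apply, cons_val_zero, cons_val_one, hij, RCLike.star_def,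
    Complex.mul_conj, sub_nonneg] at h
  have h2 : J i i * J j j ≤ 1 := mul_le_one₀ (hd i) hJ.diag_nonneg (hd j)
  have h3 : Complex.normSq (J i j) ≤ 1 := by exact_mod_cast h.trans h2
  rw [Complex.normSq_eq_norm_sq] at h3
  exact (sq_le_one_iff₀ (norm_nonneg _)).1 h3

/-- Linear maps on operators, parametrized by the images of the matrix units. The parameter space
carries a topology, which the space of linear maps does not. -/
noncomputable def ofUnits (X A : QSys) :
    (X.carrier × X.carrier → A.Op) ≃ₗ[ℂ] (X.Op →ₗ[ℂ] A.Op) :=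
  (Matrix.stdBasis ℂ X.carrier X.carrier).constr ℂ

theorem ofUnits_symm_apply {X A : QSys} (f : X.Op →ₗ[ℂ] A.Op) (p : X.carrier × X.carrier) :
    (ofUnits X A).symm f p = f (single p.1 p.2 1) := by
  obtain ⟨c, rfl⟩ := (ofUnits X A).surjective f
  rw [LinearEquiv.symm_apply_apply, ← Matrix.stdBasis_eq_single]
  exact (Module.Basis.constr_basis (Matrix.stdBasis ℂ X.carrier X.carrier) ℂ c p).symm

theorem continuous_ofUnits_apply {X A : QSys} (M : X.Op) :
    Continuous fun c => ofUnits X A c M :=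
  ((LinearMap.applyₗ M).comp (ofUnits X A).toLinearMap).continuous_of_finiteDimensional

/-- The set of channels is compact. It is bounded since the diagonal entries of a Choi matrix are
nonnegative and, by trace preservation, at most one. -/
theorem isCompact_channels (X A : QSys) :
    IsCompact {c | IsCompletelyPositive (ofUnits X A c) ∧
      ∀ M, (ofUnits X A c M).trace = M.trace} := by
  refine IsCompact.of_isClosed_subset (s := Set.univ.pi fun _ : X.carrier × X.carrier =>
    (Set.univ.pi fun _ => Set.univ.pi fun _ => Metric.closedBall (0 : ℂ) 1 : Set A.Op))
    (isCompact_univ_pi fun _ => isCompact_univ_pi fun _ => isCompact_univ_pi fun _ =>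
      isCompact_closedBall _ _) ?_ ?_
  · simp only [IsCompletelyPositive, Set.ofPred_and, Set.ofPred_forall]
    refine IsClosed.inter ?_ ?_
    · refine isClosed_iInter fun κ => isClosed_iInter fun _ => isClosed_iInter fun M =>
        isClosed_iInter fun _ => (isClosed_posSemidef _).preimage ?_
      refine continuous_matrix fun p q => ?_
      exact (continuous_ofUnits_apply _).matrix_elem _ _
    · exact isClosed_iInter fun M =>
        isClosed_eq (continuous_ofUnits_apply M).matrix_trace continuous_const
  · refine fun (c : X.carrier × X.carrier → A.Op) ⟨hcp, htp⟩ ⟨i, j⟩ _ a _ b _ => ?_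
    have hJ := posSemidef_choi hcp
    rw [mem_closedBall_zero_iff]
    have hc : c (i, j) = ofUnits X A c (single i j 1) := by
      rw [← ofUnits_symm_apply _ (i, j), LinearEquiv.symm_apply_apply]
    rw [hc]
    refine norm_apply_le_one hJ ?_ (i, a) (j, b)
    rintro ⟨k, d⟩
    have htr : (ofUnits X A c (single k k 1)).trace = 1 :=
      (htp _).trans (trace_single_eq_same _ _)
    refine le_of_le_of_eq ?_ htr
    exact Finset.single_le_sum (f := fun d => ofUnits X A c (single k k 1) d d)
      (fun d _ => hJ.diag_nonneg (i := (k, d))) (Finset.mem_univ d)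

/-- If Bob has no input, then every game has an optimal quantum score. -/
theorem exists_isOptimalQuantumScore {P : Scenario} (hY : Fintype.card P.Y.sys.carrier = 1)
    (G : P.Game) : ∃ ω : ℝ, IsOptimalQuantumScore G ω := by
  let V := P.X.sys.tensor P.Y.sys
  let W := P.A.sys.tensor P.B.sys
  let e : (P.X.sys ⊗ P.Y.sys : QSys) ⟶ P.X.sys ⊗ P.Y.sys :=
    (discard P.X.sys ≫ someState P.X.sys) ▷ P.Y.sys
  let d : (P.A.sys ⊗ P.B.sys : QSys) ⟶ 𝟙_ QSys ⊗ P.B.sys := discard P.A.sys ▷ P.B.sys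
  let p : (P.X.sys ⊗ P.Y.sys : QSys) ⟶ P.X.sys ⊗ P.Y.sys := P.X.proj ⊗ₘ P.Y.proj
  let q : (P.A.sys ⊗ P.B.sys : QSys) ⟶ P.A.sys ⊗ P.B.sys := P.A.proj ⊗ₘ P.B.proj
  -- The LOSE-free channels are the channels that satisfy two linear equations.
  let K : Set (V.carrier × V.carrier → W.Op) :=
    {c | IsCompletelyPositive (ofUnits V W c) ∧ ∀ M, (ofUnits V W c M).trace = M.trace} ∩
      {c | (∀ M, Channel.map q (ofUnits V W c (Channel.map p M)) = ofUnits V W c M) ∧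
        ∀ M, Channel.map d (ofUnits V W c (Channel.map e M)) = Channel.map d (ofUnits V W c M)}
  have hK : IsCompact K := by
    refine (isCompact_channels V W).inter_right ?_
    simp only [Set.ofPred_and, Set.ofPred_forall]
    have hq : Continuous (Channel.map q) := LinearMap.continuous_of_finiteDimensional _
    have hd : Continuous (Channel.map d) := LinearMap.continuous_of_finiteDimensional _
    exact (isClosed_iInter fun M => isClosed_eq (hq.comp (continuous_ofUnits_apply _))
      (continuous_ofUnits_apply _)).inter (isClosed_iInter fun M =>
        isClosed_eq (hd.comp (continuous_ofUnits_apply _)) (hd.comp (continuous_ofUnits_apply _)))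
  have hG : Continuous fun c => G (ofUnits V W c) :=
    (G.comp ((ofUnits V W).toLinearMap.restrictScalars ℝ)).continuous_of_finiteDimensional
  have hmem : ∀ E : P.Chan, P.IsFree E ↔ (ofUnits V W).symm (Channel.map E) ∈ K := by
    intro E
    simp only [K, Set.mem_inter_iff, Set.mem_ofPred_eq, LinearEquiv.apply_symm_apply]
    have htyped : P.Typed E ↔
        ∀ M, Channel.map q (Channel.map E (Channel.map p M)) = Channel.map E M :=
      ⟨fun h M => LinearMap.congr_fun (congrArg Channel.map h) M,
        fun h => Channel.ext (LinearMap.ext h)⟩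
    have hns : P.NonsignalingAliceToBob E ↔
        ∀ M, Channel.map d (Channel.map E (Channel.map e M)) =
          Channel.map d (Channel.map E M) := by
      rw [Scenario.nonsignalingAliceToBob_iff]
      exact ⟨fun h M => LinearMap.congr_fun (congrArg Channel.map h) M,
        fun h => Channel.ext (LinearMap.ext h)⟩
    rw [← htyped, ← hns]
    exact ⟨fun h => ⟨⟨Channel.cp E, Channel.tp E⟩, P.typed_of_isFree h,
      P.nonsignalingAliceToBob_of_isFree h⟩,
      fun h => P.isFree_of_nonsignalingAliceToBob hY h.2.1 h.2.2⟩
  have himage : G.score '' {E | P.IsFree E} = (fun c => G (ofUnits V W c)) '' K := by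
    ext r
    constructor
    · rintro ⟨E, hE, rfl⟩
      exact ⟨_, (hmem E).1 hE, congrArg G (LinearEquiv.apply_symm_apply _ _)⟩
    · rintro ⟨c, hc, rfl⟩
      refine ⟨⟨ofUnits V W c, hc.1.1, hc.1.2⟩, (hmem _).2 ?_, rfl⟩
      rwa [LinearEquiv.symm_apply_apply]
  obtain ⟨E, hE⟩ := P.exists_isFree
  change ∃ ω, IsGreatest (G.score '' {E | P.IsFree E}) ω
  rw [himage]
  exact (hK.image hG).exists_isGreatest (himage ▸ ⟨_, E, hE, rfl⟩)

end Compactness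

end LOSE

theorem mainTheorem6 :
    LOSE.LOSETrivial LOSE.GlobalType.steering ∧
    LOSE.LOSETrivial LOSE.GlobalType.teleportage ∧
    ∀ P : LOSE.Scenario,
      (P.type = LOSE.GlobalType.steering ∨ P.type = LOSE.GlobalType.teleportage) →
      (∀ (𝒢 : LOSE.GPT.{u, v}) (E : P.Chan), P.Typed E → 𝒢.Realizes E → P.IsFree E) ∧
      ∀ G : P.Game, ∃ ω : ℝ,
        LOSE.IsOptimalQuantumScore G ω ∧
        (∀ (𝒢 : LOSE.GPT.{u, v}) (E : P.Chan), P.Typed E → 𝒢.Realizes E → G.score E ≤ ω) ∧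
        ∀ (R : LOSE.Scenario) (E : R.Chan), R.IsResource E →
          LOSE.IsOptimalPerformance G E ω := by
  have hY : ∀ P : LOSE.Scenario,
      (P.type = LOSE.GlobalType.steering ∨ P.type = LOSE.GlobalType.teleportage) →
      Fintype.card P.Y.sys.carrier = 1 := by
    intro P hP
    apply P.Y.card_of_trivial
    rcases hP with hP | hP <;> exact congrArg LOSE.GlobalType.Y hP
  refine ⟨fun P hP E hE => P.isFree_of_nonsignalingAliceToBob (hY P (.inl hP)) hE.1 hE.2,
    fun P hP E hE => P.isFree_of_nonsignalingAliceToBob (hY P (.inr hP)) hE.1 hE.2,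
    fun P hP => ?_⟩
  have hGPT : ∀ (𝒢 : LOSE.GPT.{u, v}) (E : P.Chan), P.Typed E → 𝒢.Realizes E → P.IsFree E :=
    fun 𝒢 E ht hE => P.isFree_of_nonsignalingAliceToBob (hY P hP) ht
      (P.nonsignalingAliceToBob_of_realizes hE)
  refine ⟨hGPT, fun G => ?_⟩
  obtain ⟨ω, hω⟩ := LOSE.exists_isOptimalQuantumScore (hY P hP) G
  refine ⟨ω, hω, fun 𝒢 E ht hE => hω.2 ⟨E, hGPT 𝒢 E ht hE, rfl⟩, fun R E hE => ⟨?_, ?_⟩⟩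
  · obtain ⟨E', hE', h⟩ := hω.1
    obtain ⟨τ, hτ⟩ := LOSE.exists_apply_eq_of_isFree E hE'
    exact ⟨τ, by simp only [hτ, h]⟩
  · rintro _ ⟨τ, rfl⟩
    exact hω.2 ⟨_, P.isFree_of_nonsignalingAliceToBob (hY P hP) (τ.typed_apply E)
      (τ.nonsignalingAliceToBob_apply hE.2), rfl⟩
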